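/- Let $n\ge 1$. For real $n\times n$ matrices $Q_1,\dots,Q_n$ let $$D(Q_1,\dots,Q_n)=\frac{\partial^n}{\partial t_1\cdots\partial t_n}\det(t_1Q_1+\cdots+t_nQ_n)$$ be their mixed discriminant. Let $Q_1,\dots,Q_n$ be symmetric positive semidefinite, let $T_1,\dots,T_n$ be any real $n\times n$ matrices with $Q_i=T_iT_i^*$, where $T_i^*$ is the transpose of $T_i$, let $u_1,\dots,u_n$ be independent random vectors with the standard Gaussian distribution in $\mathbb R^n$, and let $$\alpha=\bigl(\det[T_1u_1,\dots,T_nu_n]\bigr)^2$$ be the squared determinant of the matrix with columns $T_1u_1,\dots,T_nu_n$. Write $D=D(Q_1,\dots,Q_n)$. 1. $\alpha$ is integrable and $\mathbf E(\alpha)=D$. 2. If $D\neq 0$, then for every $C>1$ we have $\mathbf P(\alpha\ge C\cdot D)\le C^{-1}$. 3. Let $$c_0=\exp\left\{\frac{4}{\sqrt{2\pi}}\int_0^{+\infty}(\ln t)\,e^{-t^2/2}\,dt\right\},$$ where the integral converges absolutely and $|c_0-0.2807297419|<10^{-9}$. If $D\neq 0$, then for every $0<\epsilon<1$ we have $$\mathbf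 P\bigl(\alpha\le(\epsilon c_0)^nD\bigr)\le\frac{8}{n\ln^2\epsilon}.$$ -/

import Mathlib

open MeasureTheory ProbabilityTheory
open scoped Matrix

noncomputable section

/-- The polynomial `det (t₁ Q₁ + ⋯ + tₙ Qₙ)` in the variables `t₁, …, tₙ`. -/
def detPencil {n : ℕ} (Q : Fin n → Matrix (Fin n) (Fin n) ℝ) : MvPolynomial (Fin n) ℝ :=
  (∑ k, (MvPolynomial.X k : MvPolynomial (Fin n) ℝ) • (Q k).map MvPolynomial.C).det

/-- The mixed discriminant `D(Q₁, …, Qₙ) = ∂ⁿ/∂t₁⋯∂tₙ det (t₁ Q₁ + ⋯ + tₙ Qₙ)`, without the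
factor `1 / n!`. The determinant is homogeneous of degree `n`, so that its `n`-th order mixed
derivative is a constant polynomial; we read off the constant by evaluating at `t = 0`. -/
def mixedDiscriminant {n : ℕ} (Q : Fin n → Matrix (Fin n) (Fin n) ℝ) : ℝ :=
  MvPolynomial.eval 0
    ((List.finRange n).foldr (fun k p => MvPolynomial.pderiv k p) (detPencil Q))

/-- `(det [T₁ x₁, …, Tₙ xₙ])²`, the squared determinant of the matrix with columns `Tⱼ xⱼ`. -/
def sqDetColumns {n : ℕ} (T : Fin n → Matrix (Fin n) (Fin n) ℝ)
    (x : Fin n → EuclideanSpace ℝ (Fin n)) : ℝ :=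
  (Matrix.of fun i j => (T j *ᵥ (x j).ofLp) i).det ^ 2

/-- `c₀ = exp ((4 / √(2π)) ∫₀^∞ (ln t) e^{-t²/2} dt)`. -/
def gaussLogConst : ℝ :=
  Real.exp (4 / √(2 * Real.pi) * ∫ t in Set.Ioi (0 : ℝ), Real.log t * Real.exp (-t ^ 2 / 2))

end

/-! The determinant with columns `T j x_j` is a multilinear form `f` in the vectors `x_j`.
Integrating out one Gaussian vector at a time gives `E f² = basisSqSum f`, the sum of `f²` over
tuples of basis vectors. Expanding determinants, with `Q j = T j (T j)ᵀ`, identifies this sum with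
the mixed discriminant `D` (`basisSqSum_detColumnsMultilinear`). The upper tail is then Markov's
inequality.

For the lower tail, freeze the first argument at `a`. The map `a ↦ basisSqSum (f.curryLeft a)` is a
positive semidefinite quadratic form with Gaussian mean `basisSqSum f`. So `log (f² / D)` telescopes
into `n` logarithms of quadratic forms, each of trace one given the vectors frozen before. By
concavity of `log`, each has conditional mean at least `E log ξ² = log c₀` for a scalar standard
Gaussian `ξ`, and its second moment is at most `8` (`stdGaussian_log_quadraticForm`). A one-sided
Chebyshev argument (`lintegral_multilinear_log`) bounds the squared deficit below `n log c₀` by `8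
n` in mean, and dividing by `(n log ε)²` gives the tail.

The value of `c₀` follows from `Γ'(1/2)`: `c₀ = exp (-γ - log 2)`. -/

/-! ### Numerical bounds for Euler's constant and for `exp (-γ - log 2)`. -/

section EulerMascheroni
open Filter Topology

/-- Puts the increment in the form `2 artanh (1 / (2x + 1))`, whose power series has positive terms
and converges fast. -/
lemma log_add_one_sub_log_eq (x : ℝ) (hx : 0 < x) :
    Real.log (x + 1) - Real.log x =
      2 * (1 / 2 * Real.log ((1 + 1 / (2 * x + 1)) / (1 - 1 / (2 * x + 1)))) := by
  rw [← Real.log_div (by positivity) (by positivity)]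
  have : (1 + 1 / (2 * x + 1)) / (1 - 1 / (2 * x + 1)) = (x + 1) / x := by
    have : (1 - 1 / (2 * x + 1)) ≠ 0 := by
      have : 1 - 1 / (2 * x + 1) = 2 * x / (2 * x + 1) := by field_simp; ring
      rw [this]; positivity
    rw [div_eq_div_iff this hx.ne']
    field_simp
    ring
  rw [this]
  ring

lemma le_log_add_one_sub_log (x : ℝ) (hx : 0 < x) :
    1 / 2 * (1 / x + 1 / (x + 1)) - 1 / 12 * (1 / x ^ 2 - 1 / (x + 1) ^ 2)
      ≤ Real.log (x + 1) - Real.log x := by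
  have hy : 1 / (2 * x + 1) < 1 := by
    rw [div_lt_one (by positivity)]; linarith
  have h := Real.sum_range_le_log_div (x := 1 / (2 * x + 1)) (by positivity) hy 2
  rw [log_add_one_sub_log_eq x hx]
  refine le_trans ?_ (mul_le_mul_of_nonneg_left h zero_le_two)
  simp only [Finset.sum_range_succ, Finset.sum_range_zero]
  rw [← sub_nonneg]
  have e : 2 * (0 + (1 / (2 * x + 1)) ^ (2 * 0 + 1) / (2 * ((0 : ℕ) : ℝ) + 1) +
      (1 / (2 * x + 1)) ^ (2 * 1 + 1) / (2 * ((1 : ℕ) : ℝ) + 1)) -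
      (1 / 2 * (1 / x + 1 / (x + 1)) - 1 / 12 * (1 / x ^ 2 - 1 / (x + 1) ^ 2)) =
      (2 * x ^ 2 + 2 * x + 1) / (12 * x ^ 2 * (x + 1) ^ 2 * (2 * x + 1) ^ 3) := by
    push_cast
    field_simp
    ring
  rw [e]
  positivity

lemma log_add_one_sub_log_le (x : ℝ) (hx : 0 < x) :
    Real.log (x + 1) - Real.log x ≤
      1 / 2 * (1 / x + 1 / (x + 1)) - 1 / 12 * (1 / x ^ 2 - 1 / (x + 1) ^ 2)
        + 1 / 120 * (1 / x ^ 4 - 1 / (x + 1) ^ 4) := by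
  have hy : 1 / (2 * x + 1) < 1 := by
    rw [div_lt_one (by positivity)]; linarith
  have h := Real.log_div_le_sum_range_add (x := 1 / (2 * x + 1)) (by positivity) hy 3
  rw [log_add_one_sub_log_eq x hx]
  refine le_trans (mul_le_mul_of_nonneg_left h zero_le_two) ?_
  simp only [Finset.sum_range_succ, Finset.sum_range_zero]
  rw [← sub_nonneg]
  have e1 : 1 - (1 / (2 * x + 1)) ^ 2 = 4 * x * (x + 1) / (2 * x + 1) ^ 2 := by
    field_simp; ring
  rw [e1]
  push_cast
  field_simp
  ring_nf
  positivity

/-- Euler–Maclaurin truncations: by the two preceding bounds the lower one increases and the upper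
one decreases in `n`, and both tend to `γ`. -/
lemma eulerMascheroniConstant_bounds_of_pos (n : ℕ) (hn : 0 < n) :
    (harmonic n - Real.log n - 1 / (2 * n) + 1 / (12 * n ^ 2) - 1 / (120 * n ^ 4) : ℝ) ≤
        Real.eulerMascheroniConstant ∧
      Real.eulerMascheroniConstant ≤
        (harmonic n - Real.log n - 1 / (2 * n) + 1 / (12 * n ^ 2) : ℝ) := by
  obtain ⟨m, rfl⟩ : ∃ m, n = m + 1 := ⟨n - 1, by omega⟩
  have hl : Tendsto (fun n : ℕ => (harmonic n - Real.log n : ℝ)) atTop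
      (𝓝 Real.eulerMascheroniConstant) := Real.tendsto_harmonic_sub_log
  have hz (k : ℕ) (hk : k ≠ 0) (c : ℝ) :
      Tendsto (fun n : ℕ => 1 / (c * (n : ℝ) ^ k)) atTop (𝓝 0) := by
    have h2 : Tendsto (fun n : ℕ => ((n : ℝ) ^ k)⁻¹) atTop (𝓝 0) :=
      tendsto_inv_atTop_zero.comp ((tendsto_pow_atTop hk).comp tendsto_natCast_atTop_atTop)
    simpa [mul_comm] using h2.const_mul c⁻¹
  have hc : Tendsto (fun n : ℕ => (harmonic n - Real.log n - 1 / (2 * n) + 1 / (12 * n ^ 2) : ℝ))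
      atTop (𝓝 Real.eulerMascheroniConstant) := by
    simpa only [pow_one, sub_zero, add_zero] using
      (hl.sub (hz 1 one_ne_zero 2)).add (hz 2 two_ne_zero 12)
  have hd : Tendsto (fun n : ℕ => (harmonic n - Real.log n - 1 / (2 * n) + 1 / (12 * n ^ 2)
      - 1 / (120 * n ^ 4) : ℝ)) atTop (𝓝 Real.eulerMascheroniConstant) := by
    simpa using hc.sub (hz 4 four_ne_zero 120)
  constructor
  · refine Monotone.ge_of_tendsto (monotone_nat_of_le_succ fun k => ?_)
      ((tendsto_add_atTop_iff_nat 1).2 hd) m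
    have h := log_add_one_sub_log_le (k + 1) (by positivity)
    rw [harmonic_succ (k + 1)]
    push_cast
    simp only [one_div, mul_inv] at h ⊢
    linarith
  · refine Antitone.le_of_tendsto (antitone_nat_of_succ_le fun k => ?_)
      ((tendsto_add_atTop_iff_nat 1).2 hc) m
    have h := le_log_add_one_sub_log (k + 1) (by positivity)
    rw [harmonic_succ (k + 1)]
    push_cast
    simp only [one_div, mul_inv] at h ⊢
    linarith

lemma eulerMascheroniConstant_add_log_two_mem :
    Real.eulerMascheroniConstant + Real.log 2 ∈
      Set.Icc (1.270362843 : ℝ) (1.270362848 : ℝ) := by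
  -- At `n = 64` the gap `1 / (120 n⁴)` is about `5e-10`, and a power of two makes `log n` a
  -- multiple of `log 2`.
  obtain ⟨h1, h2⟩ := eulerMascheroniConstant_bounds_of_pos 64 (by norm_num)
  have hlog : Real.log ((64 : ℕ) : ℝ) = 6 * Real.log 2 := by
    rw [show ((64 : ℕ) : ℝ) = 2 ^ 6 by norm_num, Real.log_pow]; norm_num
  have hl := abs_le.1 Real.log_two_near_10
  have hh : harmonic 64 =
      623171679694215690971693339 / 131362987122535807501262400 := by
    decide +kernel
  rw [hlog, hh] at h1 h2
  push_cast at h1 h2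
  constructor
  · norm_num at h1 hl ⊢; linarith
  · norm_num at h2 hl ⊢; linarith

lemma abs_exp_neg_eulerMascheroniConstant_sub_log_two_sub_lt :
    |Real.exp (-Real.eulerMascheroniConstant - Real.log 2) - 0.2807297419| < 10 ^ (-9 : ℤ) := by
  obtain ⟨h1, h2⟩ := eulerMascheroniConstant_add_log_two_mem
  have bound (x : ℝ) (hx : |x| ≤ 1) :=
    Real.exp_bound (x := x) hx (n := 14) (by norm_num)
  have k1 := abs_le.1 (bound (-(1.270362843 / 2)) (by rw [abs_le]; norm_num))
  have k2 := abs_le.1 (bound (-(1.270362848 / 2)) (by rw [abs_le]; norm_num))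
  -- The Taylor bound needs an argument of modulus at most `1`, so the exponent is halved and the
  -- result squared.
  have e (s : ℝ) : Real.exp (-s) = Real.exp (-(s / 2)) ^ 2 := by
    rw [← Real.exp_nat_mul]; congr 1; push_cast; ring
  have m1 : Real.exp (-Real.eulerMascheroniConstant - Real.log 2) ≤ Real.exp (-1.270362843) :=
    Real.exp_le_exp.2 (by linarith)
  have m2 : Real.exp (-1.270362848) ≤ Real.exp (-Real.eulerMascheroniConstant - Real.log 2) :=
    Real.exp_le_exp.2 (by linarith)
  rw [e] at m1 m2
  simp only [Finset.sum_range_succ, Finset.sum_range_zero, Nat.factorial] at k1 k2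
  have u1 : Real.exp (-(1.270362843 / 2)) ≤ 0.5298393554 := by
    have := k1.2
    norm_num at this ⊢
    linarith
  have u2 : 0.529839354 ≤ Real.exp (-(1.270362848 / 2)) := by
    have := k2.1
    norm_num at this ⊢
    linarith
  have w1 := pow_le_pow_left₀ (Real.exp_pos _).le u1 2
  have w2 := pow_le_pow_left₀ (by norm_num) u2 2
  rw [abs_lt]
  constructor
  · norm_num at m2 w2 ⊢; linarith
  · norm_num at m1 w1 ⊢; linarith

end EulerMascheroni

/-! ### The integral defining `c₀`, evaluated through the Gamma function. -/

section LogGaussian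
open Filter Topology Set

lemma integrableOn_log_mul_exp_neg_sq_div_two :
    IntegrableOn (fun t : ℝ => Real.log t * Real.exp (-t ^ 2 / 2)) (Ioi 0) := by
  have h1 : IntegrableOn (fun t : ℝ => Real.log t * Real.exp (-t ^ 2 / 2)) (Ioc 0 1) := by
    have := (intervalIntegral.intervalIntegrable_log' (a := 0) (b := 1))
    rw [intervalIntegrable_iff_integrableOn_Ioc_of_le zero_le_one] at this
    refine Integrable.mono this (by fun_prop) (ae_of_all _ fun t => ?_)
    rw [norm_mul]
    refine mul_le_of_le_one_right (norm_nonneg _) ?_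
    rw [Real.norm_eq_abs, Real.abs_exp, Real.exp_le_one_iff]
    nlinarith [sq_nonneg t]
  have h2 : IntegrableOn (fun t : ℝ => Real.log t * Real.exp (-t ^ 2 / 2)) (Ioi 1) := by
    have := (integrable_mul_exp_neg_mul_sq (b := 1 / 2) (by norm_num)).integrableOn (s := Ioi 1)
    refine Integrable.mono this (by fun_prop) ?_
    refine (ae_restrict_iff' measurableSet_Ioi).2 (ae_of_all _ fun t (ht : 1 < t) => ?_)
    rw [norm_mul, norm_mul, show -t ^ 2 / 2 = -(1 / 2) * t ^ 2 by ring]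
    refine mul_le_mul_of_nonneg_right ?_ (norm_nonneg _)
    rw [Real.norm_of_nonneg (Real.log_nonneg ht.le), Real.norm_of_nonneg (by linarith)]
    linarith [Real.log_le_sub_one_of_pos (by linarith : 0 < t)]
  have := h1.union h2
  rwa [Ioc_union_Ioi_eq_Ioi zero_le_one] at this

/-- This is `Γ'(1/2)`, by differentiating Euler's integral under the integral sign. -/
lemma integral_rpow_neg_half_mul_log_mul_exp_neg :
    ∫ t in Ioi (0 : ℝ), t ^ (-(1 / 2) : ℝ) * (Real.log t * Real.exp (-t)) =
      -√Real.pi * (Real.eulerMascheroniConstant + 2 * Real.log 2) := by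
  have h1 := Complex.hasDerivAt_GammaIntegral (s := ((1 / 2 : ℝ) : ℂ)) (by norm_num)
  have h2 := Complex.hasDerivAt_Gamma_one_half
  have h3 : Complex.GammaIntegral =ᶠ[𝓝 (((1 / 2 : ℝ) : ℂ))] Complex.Gamma := by
    have : {z : ℂ | 0 < z.re} ∈ 𝓝 (((1 / 2 : ℝ) : ℂ)) :=
      (isOpen_lt continuous_const Complex.continuous_re).mem_nhds (by norm_num)
    filter_upwards [this] with z hz using (Complex.Gamma_eq_integral hz).symm
  have h4 := (h1.congr_of_eventuallyEq h3.symm).unique (by simpa using h2)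
  apply Complex.ofReal_injective
  rw [← integral_complex_ofReal]
  refine Eq.trans ?_ (h4.trans ?_)
  · refine setIntegral_congr_fun measurableSet_Ioi fun t (ht : 0 < t) => ?_
    rw [Complex.ofReal_mul, Complex.ofReal_cpow ht.le]
    push_cast
    norm_num
  · push_cast
    rw [Complex.ofReal_log (by norm_num)]
    norm_num

lemma integral_log_mul_exp_neg_sq_div_two :
    ∫ t in Ioi (0 : ℝ), Real.log t * Real.exp (-t ^ 2 / 2) =
      √(2 * Real.pi) / 4 * (-Real.eulerMascheroniConstant - Real.log 2) := by
  have h0 := integral_rpow_neg_half_mul_log_mul_exp_neg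
  -- Substitution `t = x² / 2`, in two stages: scaling by `1 / 2`, then squaring.
  have h1 := integral_comp_mul_left_Ioi'
    (fun t : ℝ => t ^ (-(1 / 2) : ℝ) * (Real.log t * Real.exp (-t))) 0
    (b := 1 / 2) (by norm_num)
  rw [mul_zero, h0, ← integral_comp_rpow_Ioi_of_pos (p := 2) (by norm_num)] at h1
  have hg : ∫ t in Ioi (0 : ℝ), Real.exp (-t ^ 2 / 2) = √(2 * Real.pi) / 2 := by
    have := integral_gaussian_Ioi (1 / 2)
    rw [show Real.pi / (1 / 2) = 2 * Real.pi by ring] at this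
    rw [← this]
    congr! 3
    ring
  have hi : IntegrableOn (fun t : ℝ => Real.exp (-t ^ 2 / 2)) (Ioi 0) := by
    convert (integrable_exp_neg_mul_sq (b := 1 / 2) (by norm_num)).integrableOn using 3
    ring
  have e : ∫ x in Ioi (0 : ℝ), ((2 : ℝ) * x ^ ((2 : ℝ) - 1)) •
      ((1 / 2 * x ^ (2 : ℝ)) ^ (-(1 / 2) : ℝ) *
        (Real.log (1 / 2 * x ^ (2 : ℝ)) * Real.exp (-(1 / 2 * x ^ (2 : ℝ))))) =
      ∫ x in Ioi (0 : ℝ), ((4 * √2) * (Real.log x * Real.exp (-x ^ 2 / 2)) -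
        (2 * √2 * Real.log 2) * Real.exp (-x ^ 2 / 2)) := by
    refine setIntegral_congr_fun measurableSet_Ioi fun x (hx : 0 < x) => ?_
    simp only [smul_eq_mul]
    have a1 : x ^ (2 : ℝ) = x ^ 2 := by norm_cast
    have a2 : (1 / 2 * x ^ 2) ^ (-(1 / 2) : ℝ) = √2 / x := by
      rw [Real.rpow_neg (by positivity), ← Real.sqrt_eq_rpow,
        Real.sqrt_mul (by norm_num), Real.sqrt_sq hx.le]
      simp [div_eq_mul_inv, mul_comm]
    have a3 : Real.log (1 / 2 * x ^ 2) = 2 * Real.log x - Real.log 2 := by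
      rw [Real.log_mul (by norm_num) (by positivity), Real.log_pow]
      simp
      ring
    have a4 : -(1 / 2 * x ^ 2) = -x ^ 2 / 2 := by ring
    rw [a1, a2, a3, a4, show (2 : ℝ) - 1 = 1 by norm_num, Real.rpow_one]
    field_simp
    ring
  rw [e, integral_sub (integrableOn_log_mul_exp_neg_sq_div_two.const_mul _) (hi.const_mul _),
    integral_const_mul, integral_const_mul, hg, smul_eq_mul] at h1
  have hs : √(2 * Real.pi) = √2 * √Real.pi := Real.sqrt_mul (by norm_num) _
  have h2 : √2 * √2 = 2 := Real.mul_self_sqrt (by norm_num)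
  have h3 : (0 : ℝ) < √2 := by positivity
  rw [hs] at h1 ⊢
  have : √2 * (∫ t in Ioi (0 : ℝ), Real.log t * Real.exp (-t ^ 2 / 2)) =
      √2 * (√2 * √Real.pi / 4 * (-Real.eulerMascheroniConstant - Real.log 2)) := by
    linear_combination h1 / 2 + (√Real.pi * (Real.eulerMascheroniConstant + 2 * Real.log 2)) / 4 * h2
  exact mul_left_cancel₀ h3.ne' this

lemma gaussLogConst_eq :
    gaussLogConst = Real.exp (-Real.eulerMascheroniConstant - Real.log 2) := by
  rw [gaussLogConst, integral_log_mul_exp_neg_sq_div_two]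
  congr 1
  have : √(2 * Real.pi) ≠ 0 := by positivity
  field_simp

end LogGaussian

/-! ### Logarithmic moments of a scalar standard Gaussian. -/

section EvenGaussian
open Filter Topology Set

lemma gaussianPDFReal_zero_one (x : ℝ) :
    gaussianPDFReal 0 1 x = (√(2 * Real.pi))⁻¹ * Real.exp (-x ^ 2 / 2) := by
  simp [gaussianPDFReal]

lemma integrable_comp_abs_of_integrableOn_Ioi {f : ℝ → ℝ} (hf : IntegrableOn f (Ioi 0)) :
    Integrable (fun x => f |x|) := by
  have h1 : IntegrableOn (fun x => f |x|) (Ioi 0) :=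
    hf.congr_fun (fun x (hx : 0 < x) => by simp only [abs_of_pos hx]) measurableSet_Ioi
  have h2 : IntegrableOn (fun x ↦ f |x|) (Iic 0) := by
    rw [← Measure.map_neg_eq_self (volume : Measure ℝ)]
    let m : MeasurableEmbedding fun x : ℝ => -x := (Homeomorph.neg ℝ).measurableEmbedding
    rw [m.integrableOn_map_iff]
    simp_rw [Function.comp_def, abs_neg, neg_preimage, neg_Iic, neg_zero]
    exact Iff.mpr integrableOn_Ici_iff_integrableOn_Ioi h1
  have := h2.union h1
  rwa [Iic_union_Ioi, integrableOn_univ] at this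

lemma gaussianReal_comp_abs {F : ℝ → ℝ}
    (hF : IntegrableOn (fun t => F t * Real.exp (-t ^ 2 / 2)) (Ioi 0)) :
    Integrable (fun x => F |x|) (gaussianReal 0 1) ∧
      ∫ x, F |x| ∂(gaussianReal 0 1) =
        2 / √(2 * Real.pi) * ∫ t in Ioi 0, F t * Real.exp (-t ^ 2 / 2) := by
  have e (x : ℝ) : gaussianPDFReal 0 1 x • F |x| =
      (√(2 * Real.pi))⁻¹ * (F |x| * Real.exp (-|x| ^ 2 / 2)) := by
    rw [gaussianPDFReal_zero_one, sq_abs, smul_eq_mul]; ring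
  constructor
  · rw [gaussianReal_of_var_ne_zero _ one_ne_zero,
      integrable_withDensity_iff_integrable_smul' (measurable_gaussianPDF _ _)
        (ae_of_all _ fun _ => gaussianPDF_lt_top)]
    simp only [toReal_gaussianPDF, e]
    exact (integrable_comp_abs_of_integrableOn_Ioi hF).const_mul _
  · rw [integral_gaussianReal_eq_integral_smul one_ne_zero]
    simp only [e]
    rw [integral_const_mul, integral_comp_abs (f := fun t => F t * Real.exp (-t ^ 2 / 2))]
    ring

lemma gaussianReal_log_sq :
    Integrable (fun x => Real.log (x ^ 2)) (gaussianReal 0 1) ∧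
      ∫ x, Real.log (x ^ 2) ∂(gaussianReal 0 1) = Real.log gaussLogConst := by
  have h := gaussianReal_comp_abs (F := fun t => 2 * Real.log t) (by
    simp only [mul_assoc]
    exact integrableOn_log_mul_exp_neg_sq_div_two.const_mul 2)
  have e (x : ℝ) : 2 * Real.log |x| = Real.log (x ^ 2) := by
    rw [Real.log_abs, Real.log_pow]; norm_num
  simp only [e, mul_assoc] at h
  refine ⟨h.1, h.2.trans ?_⟩
  rw [integral_const_mul, gaussLogConst, Real.log_exp]
  ring

lemma integrableOn_log_sq_Ioc_and_integral :
    IntegrableOn (fun t : ℝ => Real.log t ^ 2) (Ioc 0 1) ∧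
      ∫ t in Ioc (0 : ℝ) 1, Real.log t ^ 2 = 2 := by
  -- The antiderivative `t log² t - 2 t log t + 2 t`, with its first term written through `√t log
  -- √t` so that continuity at `0` is visible.
  let G : ℝ → ℝ := fun t => 4 * (√t * Real.log √t) ^ 2 - 2 * (t * Real.log t) + 2 * t
  have hc : ContinuousOn G (Icc 0 1) := by
    have h1 : Continuous fun t : ℝ => √t * Real.log √t :=
      Real.continuous_mul_log.comp Real.continuous_sqrt
    have h2 := Real.continuous_mul_log
    exact Continuous.continuousOn (by fun_prop)
  have hd : ∀ x ∈ Ioo (0 : ℝ) 1, HasDerivAt G (Real.log x ^ 2) x := by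
    intro x hx
    have h1 : HasDerivAt (fun t => t * Real.log t ^ 2 - 2 * (t * Real.log t) + 2 * t)
        (Real.log x ^ 2) x := by
      have hl := Real.hasDerivAt_log hx.1.ne'
      have hi := hasDerivAt_id x
      have := ((hi.mul (hl.pow 2)).sub ((hi.mul hl).const_mul 2)).add (hi.const_mul 2)
      convert! this using 1
      have := hx.1.ne'
      simp
      field_simp
      ring
    refine h1.congr_of_eventuallyEq ?_
    filter_upwards [lt_mem_nhds hx.1] with t ht
    simp only [G, mul_pow, Real.sq_sqrt ht.le, Real.log_sqrt ht.le]
    ring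
  have hi := intervalIntegral.integrableOn_deriv_of_nonneg hc hd (fun x _ => sq_nonneg _)
  refine ⟨hi, ?_⟩
  have := intervalIntegral.integral_eq_sub_of_hasDerivAt_of_le zero_le_one hc hd
    ((intervalIntegrable_iff_integrableOn_Ioc_of_le zero_le_one).2 hi)
  rw [intervalIntegral.integral_of_le zero_le_one] at this
  rw [this]
  simp [G]

/-- The second moment of the negative part of `log ξ²` for a standard Gaussian `ξ`. -/
lemma gaussianReal_min_log_sq_sq :
    Integrable (fun x => (min (Real.log (x ^ 2)) 0) ^ 2) (gaussianReal 0 1) ∧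
      ∫ x, (min (Real.log (x ^ 2)) 0) ^ 2 ∂(gaussianReal 0 1) ≤ 7 := by
  obtain ⟨hi, hv⟩ := integrableOn_log_sq_Ioc_and_integral
  have hind : IntegrableOn ((Ioc 0 1).indicator fun t : ℝ => 4 * Real.log t ^ 2) (Ioi 0) :=
    ((integrable_indicator_iff measurableSet_Ioc).2 (hi.const_mul 4)).integrableOn
  have hb : ∀ t : ℝ, 0 < t → (min (2 * Real.log t) 0) ^ 2 * Real.exp (-t ^ 2 / 2) ≤
      (Ioc 0 1).indicator (fun t : ℝ => 4 * Real.log t ^ 2) t := by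
    intro t ht
    rcases le_or_gt t 1 with h | h
    · rw [indicator_of_mem (show t ∈ Ioc (0 : ℝ) 1 from ⟨ht, h⟩),
        min_eq_left (by linarith [Real.log_nonpos ht.le h])]
      have : Real.exp (-t ^ 2 / 2) ≤ 1 := Real.exp_le_one_iff.2 (by nlinarith [sq_nonneg t])
      nlinarith [sq_nonneg (Real.log t)]
    · rw [indicator_of_notMem (fun h' => absurd h'.2 (not_le.2 h)),
        min_eq_right (by linarith [Real.log_nonneg h.le])]
      simp
  have hm : IntegrableOn (fun t : ℝ => (min (2 * Real.log t) 0) ^ 2 * Real.exp (-t ^ 2 / 2))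
      (Ioi 0) := by
    refine Integrable.mono' hind (by fun_prop) ?_
    refine (ae_restrict_iff' measurableSet_Ioi).2 (ae_of_all _ fun t ht => ?_)
    rw [Real.norm_of_nonneg (by positivity)]
    exact hb t ht
  have h := gaussianReal_comp_abs (F := fun t => (min (2 * Real.log t) 0) ^ 2) hm
  have e (x : ℝ) : 2 * Real.log |x| = Real.log (x ^ 2) := by
    rw [Real.log_abs, Real.log_pow]; norm_num
  simp only [e] at h
  refine ⟨h.1, h.2.le.trans ?_⟩
  -- The integrand vanishes beyond `1`; on `(0, 1]` drop the exponential and use `4 ∫ log² t = 8`.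
  have h8 : ∫ t in Ioi (0 : ℝ), (min (2 * Real.log t) 0) ^ 2 * Real.exp (-t ^ 2 / 2) ≤ 8 := by
    refine (setIntegral_mono_on hm hind measurableSet_Ioi hb).trans_eq ?_
    rw [setIntegral_indicator measurableSet_Ioc, inter_eq_right.2 Ioc_subset_Ioi_self,
      integral_const_mul, hv]
    norm_num
  have hs : 5 / 2 ≤ √(2 * Real.pi) :=
    Real.le_sqrt_of_sq_le (by nlinarith [Real.pi_gt_d2])
  calc 2 / √(2 * Real.pi) * _ ≤ 2 / √(2 * Real.pi) * 8 := by gcongr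
    _ ≤ 2 / (5 / 2) * 8 := by gcongr
    _ ≤ 7 := by norm_num

end EvenGaussian

/-! ### Logarithms of trace-one quadratic forms at a Gaussian vector. -/

section QuadraticForm
open Filter Topology Set

lemma log_sq_le_self {x : ℝ} (hx : 1 ≤ x) : Real.log x ^ 2 ≤ x := by
  have h0 : 0 < x := by linarith
  have hs : 0 < √x := Real.sqrt_pos.2 h0
  have h1 : Real.log x ≤ √x := by
    have h2 : Real.log (√x / 2) ≤ √x / 2 - 1 := Real.log_le_sub_one_of_pos (by positivity)
    rw [Real.log_div hs.ne' two_ne_zero, Real.log_sqrt h0.le] at h2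
    linarith [Real.log_two_lt_d9]
  calc Real.log x ^ 2 ≤ √x ^ 2 := pow_le_pow_left₀ (Real.log_nonneg hx) h1 2
    _ = x := Real.sq_sqrt h0.le

variable {ι : Type*} [Fintype ι]

lemma sum_mul_log_le_log_sum {w y : ι → ℝ} (hw : ∀ i, 0 ≤ w i) (hw1 : ∑ i, w i = 1)
    (hy : ∀ i, 0 < y i) : ∑ i, w i * Real.log (y i) ≤ Real.log (∑ i, w i * y i) := by
  simpa using strictConcaveOn_log_Ioi.concaveOn.le_map_sum (t := Finset.univ)
    (fun i _ => hw i) hw1 (fun i _ => hy i)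

/-- Above `1`, `log² q ≤ q`. Below `1`, Jensen gives `0 ≥ log q ≥ ∑ w min (log y) 0`, and convexity
of the square finishes. -/
lemma log_sum_sq_le {w y : ι → ℝ} (hw : ∀ i, 0 ≤ w i) (hw1 : ∑ i, w i = 1)
    (hy : ∀ i, 0 < y i) :
    Real.log (∑ i, w i * y i) ^ 2 ≤
      ∑ i, w i * (min (Real.log (y i)) 0) ^ 2 + ∑ i, w i * y i := by
  have hq : 0 ≤ ∑ i, w i * y i := Finset.sum_nonneg fun i _ => mul_nonneg (hw i) (hy i).le
  have hm : 0 ≤ ∑ i, w i * (min (Real.log (y i)) 0) ^ 2 :=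
    Finset.sum_nonneg fun i _ => mul_nonneg (hw i) (sq_nonneg _)
  rcases le_total 1 (∑ i, w i * y i) with h | h
  · linarith [log_sq_le_self h]
  · have h1 : ∑ i, w i * min (Real.log (y i)) 0 ≤ Real.log (∑ i, w i * y i) :=
      (Finset.sum_le_sum fun i _ => mul_le_mul_of_nonneg_left (min_le_left _ _) (hw i)).trans
        (sum_mul_log_le_log_sum hw hw1 hy)
    have h2 := Real.log_nonpos hq h
    have h3 : (∑ i, w i * min (Real.log (y i)) 0) ^ 2 ≤
        ∑ i, w i * (min (Real.log (y i)) 0) ^ 2 := by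
      simpa using (even_two.convexOn_pow (𝕜 := ℝ)).map_sum_le (t := Finset.univ)
        (fun i _ => hw i) hw1 (fun i _ => mem_univ (min (Real.log (y i)) 0))
    nlinarith

variable {E : Type*} [NormedAddCommGroup E] [InnerProductSpace ℝ E] [FiniteDimensional ℝ E]
  [MeasurableSpace E] [BorelSpace E]

lemma stdGaussian_map_dual_of_norm_eq_one (L : StrongDual ℝ E) (hL : ‖L‖ = 1) :
    (stdGaussian E).map L = gaussianReal 0 1 := by
  rw [IsGaussian.map_eq_gaussianReal, integral_strongDual_stdGaussian, variance_dual_stdGaussian,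
    hL]
  simp

lemma stdGaussian_comp_dual (L : StrongDual ℝ E) (hL : ‖L‖ = 1) {f : ℝ → ℝ}
    (hf : Integrable f (gaussianReal 0 1)) :
    Integrable (fun x => f (L x)) (stdGaussian E) ∧
      ∫ x, f (L x) ∂(stdGaussian E) = ∫ y, f y ∂(gaussianReal 0 1) := by
  rw [← stdGaussian_map_dual_of_norm_eq_one L hL] at hf ⊢
  have hm : AEMeasurable L (stdGaussian E) := L.continuous.aemeasurable
  exact ⟨hf.comp_aemeasurable hm, (integral_map hm hf.aestronglyMeasurable).symm⟩

lemma stdGaussian_ae_dual_ne_zero (L : StrongDual ℝ E) (hL : ‖L‖ = 1) :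
    ∀ᵐ x ∂(stdGaussian E), L x ≠ 0 := by
  have hm : AEMeasurable L (stdGaussian E) := L.continuous.aemeasurable
  have := nullSingletonClass_gaussianReal (μ := 0) (v := 1) one_ne_zero
  have h : ∀ᵐ y ∂((stdGaussian E).map L), y ≠ 0 := by
    rw [stdGaussian_map_dual_of_norm_eq_one L hL]
    simp [ae_iff]
  exact ae_of_ae_map hm h

lemma gaussianReal_sq :
    Integrable (fun x => x ^ 2) (gaussianReal 0 1) ∧ ∫ x, x ^ 2 ∂(gaussianReal 0 1) = 1 := by
  refine ⟨(memLp_id_gaussianReal (μ := 0) (v := 1) 2).integrable_sq, ?_⟩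
  have := variance_id_gaussianReal (μ := 0) (v := 1)
  rw [variance_of_integral_eq_zero (by fun_prop) (by simp)] at this
  simpa using this

/-- For a positive semidefinite quadratic form `q = ∑ wᵢ vᵢ²` of trace one, the logarithm of `q`
at a standard Gaussian vector has mean at least `log c₀` and second moment at most `8`. -/
lemma stdGaussian_log_quadraticForm {w : ι → ℝ} {v : ι → StrongDual ℝ E} (hw : ∀ i, 0 ≤ w i)
    (hw1 : ∑ i, w i = 1) (hv : ∀ i, ‖v i‖ = 1) :
    MemLp (fun x => Real.log (∑ i, w i * v i x ^ 2)) 2 (stdGaussian E) ∧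
      Real.log gaussLogConst ≤ ∫ x, Real.log (∑ i, w i * v i x ^ 2) ∂(stdGaussian E) ∧
      ∫ x, Real.log (∑ i, w i * v i x ^ 2) ^ 2 ∂(stdGaussian E) ≤ 8 := by
  have hne : ∀ᵐ x ∂(stdGaussian E), ∀ i, 0 < v i x ^ 2 := by
    rw [ae_all_iff]
    intro i
    filter_upwards [stdGaussian_ae_dual_ne_zero (v i) (hv i)] with x hx
    positivity
  have hmeas : Measurable fun x => Real.log (∑ i, w i * v i x ^ 2) := by fun_prop
  have hA i := stdGaussian_comp_dual (v i) (hv i) gaussianReal_log_sq.1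
  have hB i := stdGaussian_comp_dual (v i) (hv i) gaussianReal_min_log_sq_sq.1
  have hC i := stdGaussian_comp_dual (v i) (hv i) gaussianReal_sq.1
  have iA : Integrable (fun x => ∑ i, w i * Real.log (v i x ^ 2)) (stdGaussian E) :=
    integrable_finsetSum _ fun i _ => (hA i).1.const_mul _
  have iB : Integrable (fun x => ∑ i, w i * (min (Real.log (v i x ^ 2)) 0) ^ 2)
    (stdGaussian E) := integrable_finsetSum _ fun i _ => (hB i).1.const_mul _
  have iC : Integrable (fun x => ∑ i, w i * v i x ^ 2) (stdGaussian E) :=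
    integrable_finsetSum _ fun i _ => (hC i).1.const_mul _
  have hle : ∀ᵐ x ∂(stdGaussian E), Real.log (∑ i, w i * v i x ^ 2) ^ 2 ≤
      ∑ i, w i * (min (Real.log (v i x ^ 2)) 0) ^ 2 + ∑ i, w i * v i x ^ 2 := by
    filter_upwards [hne] with x hx using log_sum_sq_le hw hw1 hx
  have iX2 : Integrable (fun x => Real.log (∑ i, w i * v i x ^ 2) ^ 2) (stdGaussian E) := by
    refine Integrable.mono' (iB.add iC) (hmeas.pow_const 2).aestronglyMeasurable ?_
    filter_upwards [hle] with x hx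
    rw [Real.norm_of_nonneg (sq_nonneg _)]
    exact hx
  have hX : MemLp (fun x => Real.log (∑ i, w i * v i x ^ 2)) 2 (stdGaussian E) :=
    (memLp_two_iff_integrable_sq hmeas.aestronglyMeasurable).2 iX2
  refine ⟨hX, ?_, ?_⟩
  · have h1 : ∫ x, ∑ i, w i * Real.log (v i x ^ 2) ∂(stdGaussian E) = Real.log gaussLogConst := by
      rw [integral_finsetSum _ fun i _ => (hA i).1.const_mul _]
      simp only [integral_const_mul, (hA _).2, gaussianReal_log_sq.2]
      rw [← Finset.sum_mul, hw1, one_mul]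
    rw [← h1]
    refine integral_mono_ae iA (hX.integrable one_le_two) ?_
    filter_upwards [hne] with x hx using sum_mul_log_le_log_sum hw hw1 hx
  · refine (integral_mono_ae iX2 (iB.add iC) hle).trans ?_
    simp only [Pi.add_apply]
    rw [integral_add iB iC, integral_finsetSum _ fun i _ => (hB i).1.const_mul _,
      integral_finsetSum _ fun i _ => (hC i).1.const_mul _]
    simp only [integral_const_mul, (hB _).2, (hC _).2, gaussianReal_sq.2]
    rw [← Finset.sum_mul, ← Finset.sum_mul, hw1]
    -- The constant is `8 = 7 + 1`: negative part of the logarithm, plus `E ξ² = 1`.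
    linarith [gaussianReal_min_log_sq_sq.2]

/-- If `X` has mean at least `a` and second moment at most `b`, then the positive part of
`a - X + s` has second moment at most `s₊² + b`. -/
lemma lintegral_posPart_sub_add_sq_le {Ω : Type*} [MeasurableSpace Ω] {μ : Measure Ω}
    [IsProbabilityMeasure μ] {X : Ω → ℝ} (hX : MemLp X 2 μ) {a b : ℝ} (ha : a ≤ ∫ ω, X ω ∂μ)
    (hb : ∫ ω, X ω ^ 2 ∂μ ≤ b) (s : ℝ) :
    ∫⁻ ω, ENNReal.ofReal ((max (a - X ω + s) 0) ^ 2) ∂μ ≤ ENNReal.ofReal ((max s 0) ^ 2 + b) := by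
  set m := ∫ ω, X ω ∂μ with hm
  have iX : Integrable X μ := hX.integrable one_le_two
  have iX2 : Integrable (fun ω => X ω ^ 2) μ := hX.integrable_sq
  -- Raising `a` to the mean `m` and `s` to `s₊` kills the cross term: the right side has mean `s₊²
  -- + E X² - m²`.
  have key (ω : Ω) : (max (a - X ω + s) 0) ^ 2 ≤ (m + max s 0 - X ω) ^ 2 := by
    rcases le_total (a - X ω + s) 0 with h | h
    · rw [max_eq_right h, zero_pow two_ne_zero]; positivity
    · rw [max_eq_left h]
      exact pow_le_pow_left₀ h (by linarith [le_max_left s 0]) 2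
  have e (ω : Ω) : (m + max s 0 - X ω) ^ 2 =
      (m + max s 0) ^ 2 - 2 * (m + max s 0) * X ω + X ω ^ 2 := by ring
  have i1 : Integrable (fun ω => (m + max s 0 - X ω) ^ 2) μ := by
    simp only [e]
    exact ((integrable_const _).sub (iX.const_mul _)).add iX2
  calc _ ≤ ∫⁻ ω, ENNReal.ofReal ((m + max s 0 - X ω) ^ 2) ∂μ :=
        lintegral_mono fun ω => ENNReal.ofReal_le_ofReal (key ω)
    _ = ENNReal.ofReal (∫ ω, (m + max s 0 - X ω) ^ 2 ∂μ) :=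
        (ofReal_integral_eq_lintegral_ofReal i1 (ae_of_all _ fun _ => sq_nonneg _)).symm
    _ ≤ _ := by
        refine ENNReal.ofReal_le_ofReal ?_
        simp only [e]
        rw [integral_add (f := fun ω => (m + max s 0) ^ 2 - 2 * (m + max s 0) * X ω)
            ((integrable_const _).sub (iX.const_mul _)) iX2,
          integral_sub (integrable_const _) (iX.const_mul _), integral_const_mul, ← hm]
        simp
        nlinarith [sq_nonneg m]

end QuadraticForm

/-! ### Gaussian moments and logarithms of multilinear forms, by induction on the number of
arguments. -/

section Multilinear
open Filter Topology Set

variable {E : Type*} [NormedAddCommGroup E] [InnerProductSpace ℝ E]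
  {ι κ : Type*} [Fintype ι] [Fintype κ]

lemma exists_dual_norm_eq_one_smul [Nontrivial E] (L : StrongDual ℝ E) :
    ∃ v : StrongDual ℝ E, ‖v‖ = 1 ∧ L = ‖L‖ • v := by
  by_cases h : L = 0
  · obtain ⟨v, hv⟩ := exists_norm_eq (StrongDual ℝ E) zero_le_one
    exact ⟨v, hv, by simp [h]⟩
  · have : ‖L‖ ≠ 0 := norm_ne_zero_iff.2 h
    exact ⟨‖L‖⁻¹ • L, by simp [norm_smul, this], by rw [smul_smul, mul_inv_cancel₀ this, one_smul]⟩

/-- The sum of the squares of the values of a multilinear form on tuples of basis vectors. -/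
noncomputable def basisSqSum {n : ℕ} (b : OrthonormalBasis κ ℝ E)
    (f : ContinuousMultilinearMap ℝ (fun _ : Fin n => E) ℝ) : ℝ :=
  ∑ c : Fin n → κ, f (fun j => b (c j)) ^ 2

lemma basisSqSum_nonneg {n : ℕ} (b : OrthonormalBasis κ ℝ E)
    (f : ContinuousMultilinearMap ℝ (fun _ : Fin n => E) ℝ) : 0 ≤ basisSqSum b f :=
  Finset.sum_nonneg fun _ _ => sq_nonneg _

/-- The linear form in the first argument obtained by fixing the other ones. -/
noncomputable def firstArgDual {n : ℕ} (f : ContinuousMultilinearMap ℝ (fun _ : Fin (n + 1) => E) ℝ)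
    (m : Fin n → E) : StrongDual ℝ E :=
  (ContinuousMultilinearMap.apply ℝ (fun _ : Fin n => E) ℝ m).comp f.curryLeft

lemma firstArgDual_apply {n : ℕ} (f : ContinuousMultilinearMap ℝ (fun _ : Fin (n + 1) => E) ℝ)
    (m : Fin n → E) (x : E) : firstArgDual f m x = f (Fin.cons x m) := rfl

/-- Exhibits the frozen sum as a quadratic form in `x`; by Parseval, `basisSqSum_succ` computes its
trace. -/
lemma basisSqSum_curryLeft {n : ℕ} (b : OrthonormalBasis κ ℝ E)
    (f : ContinuousMultilinearMap ℝ (fun _ : Fin (n + 1) => E) ℝ) (x : E) :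
    basisSqSum b (f.curryLeft x) =
      ∑ c : Fin n → κ, firstArgDual f (fun j => b (c j)) x ^ 2 := rfl

lemma basisSqSum_succ {n : ℕ} (b : OrthonormalBasis κ ℝ E)
    (f : ContinuousMultilinearMap ℝ (fun _ : Fin (n + 1) => E) ℝ) :
    basisSqSum b f = ∑ c : Fin n → κ, ‖firstArgDual f (fun j => b (c j))‖ ^ 2 := by
  simp_rw [b.norm_dual, firstArgDual_apply]
  rw [basisSqSum, ← (Fin.consEquiv fun _ : Fin (n + 1) => κ).sum_comp, Fintype.sum_prod_type,
    Finset.sum_comm]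
  refine Finset.sum_congr rfl fun c _ => Finset.sum_congr rfl fun k _ => ?_
  congr 2
  ext j
  refine Fin.cases ?_ (fun i => ?_) j <;> simp [Fin.consEquiv]

variable [FiniteDimensional ℝ E] [MeasurableSpace E] [BorelSpace E]

lemma lintegral_stdGaussian_dual_sq (L : StrongDual ℝ E) :
    ∫⁻ x, ENNReal.ofReal (L x ^ 2) ∂(stdGaussian E) = ENNReal.ofReal (‖L‖ ^ 2) := by
  have h2 : MemLp (fun x => L x) 2 (stdGaussian E) := IsGaussian.memLp_dual _ L 2 (by simp)
  rw [← ofReal_integral_eq_lintegral_ofReal h2.integrable_sq (ae_of_all _ fun _ => sq_nonneg _),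
    ← variance_dual_stdGaussian, variance_of_integral_eq_zero L.continuous.aemeasurable
      (integral_strongDual_stdGaussian L)]

lemma lintegral_stdGaussian_sum_dual_sq (L : ι → StrongDual ℝ E) :
    ∫⁻ x, ENNReal.ofReal (∑ i, L i x ^ 2) ∂(stdGaussian E) =
      ENNReal.ofReal (∑ i, ‖L i‖ ^ 2) := by
  simp_rw [ENNReal.ofReal_sum_of_nonneg (fun i _ => sq_nonneg _)]
  rw [lintegral_finsetSum _ fun i _ => by fun_prop]
  simp_rw [lintegral_stdGaussian_dual_sq]

/-- The lower tail estimate for a positive semidefinite quadratic form, written as a sum of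
squares of linear forms. -/
lemma stdGaussian_sum_dual_sq (L : ι → StrongDual ℝ E) (hL : 0 < ∑ i, ‖L i‖ ^ 2) :
    (∀ᵐ x ∂(stdGaussian E), 0 < ∑ i, L i x ^ 2) ∧
      ∀ s : ℝ, ∫⁻ x, ENNReal.ofReal ((max (Real.log gaussLogConst + Real.log (∑ i, ‖L i‖ ^ 2) -
          Real.log (∑ i, L i x ^ 2) + s) 0) ^ 2) ∂(stdGaussian E) ≤
        ENNReal.ofReal ((max s 0) ^ 2 + 8) := by
  obtain ⟨D, hD⟩ : ∃ D, D = ∑ i, ‖L i‖ ^ 2 := ⟨_, rfl⟩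
  have hD0 : 0 < D := hD ▸ hL
  rw [← hD]
  obtain ⟨j, -, hj⟩ : ∃ j ∈ Finset.univ, ‖L j‖ ^ 2 ≠ 0 :=
    Finset.exists_ne_zero_of_sum_ne_zero hL.ne'
  have hLj : L j ≠ 0 := fun h => hj (by simp [h])
  have hE : Nontrivial E := by
    by_contra h
    rw [not_nontrivial_iff_subsingleton] at h
    exact hLj (by ext x; rw [Subsingleton.elim x 0]; simp)
  -- A vanishing `L i` still receives a unit functional, with weight `0`.
  choose v hv1 hv using fun i => exists_dual_norm_eq_one_smul (L i)
  have hw0 (i : ι) : 0 ≤ ‖L i‖ ^ 2 / D := by positivity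
  have hw1 : ∑ i, ‖L i‖ ^ 2 / D = 1 := by rw [← Finset.sum_div, ← hD, div_self hD0.ne']
  have hq (x : E) : ∑ i, L i x ^ 2 = D * ∑ i, ‖L i‖ ^ 2 / D * v i x ^ 2 := by
    rw [Finset.mul_sum]
    refine Finset.sum_congr rfl fun i _ => ?_
    conv_lhs => rw [hv i]
    simp only [smul_apply, smul_eq_mul]
    field_simp
  have hpos : ∀ᵐ x ∂(stdGaussian E), 0 < ∑ i, ‖L i‖ ^ 2 / D * v i x ^ 2 := by
    filter_upwards [stdGaussian_ae_dual_ne_zero (v j) (hv1 j)] with x hx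
    refine Finset.sum_pos' (fun i _ => mul_nonneg (hw0 i) (sq_nonneg _))
      ⟨j, Finset.mem_univ _, by positivity⟩
  obtain ⟨h2, hm, h8⟩ := stdGaussian_log_quadraticForm hw0 hw1 hv1
  refine ⟨?_, fun s => ?_⟩
  · filter_upwards [hpos] with x hx
    rw [hq]
    exact mul_pos hD0 hx
  · refine le_trans (le_of_eq (lintegral_congr_ae ?_))
      (lintegral_posPart_sub_add_sq_le h2 hm h8 s)
    filter_upwards [hpos] with x hx
    rw [hq, Real.log_mul hD0.ne' hx.ne']
    congr 4
    ring

lemma lintegral_pi_fin_succ {α : Type*} [MeasurableSpace α] (μ : Measure α) [SigmaFinite μ]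
    {n : ℕ} {g : (Fin (n + 1) → α) → ENNReal} (hg : Measurable g) :
    ∫⁻ x, g x ∂(Measure.pi fun _ => μ) =
      ∫⁻ a, ∫⁻ x, g (Fin.cons a x) ∂(Measure.pi fun _ => μ) ∂μ := by
  have h := (measurePreserving_piFinSuccAbove (fun _ : Fin (n + 1) => μ) 0).symm
  rw [← h.lintegral_comp hg, lintegral_prod _ (by fun_prop)]
  simp [MeasurableEquiv.piFinSuccAbove, Fin.insertNthEquiv]

lemma measure_pi_fin_succ {α : Type*} [MeasurableSpace α] (μ : Measure α) [SigmaFinite μ]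
    {n : ℕ} {S : Set (Fin (n + 1) → α)} (hS : MeasurableSet S) :
    (Measure.pi fun _ => μ) S =
      ∫⁻ a, (Measure.pi fun _ : Fin n => μ) {x | Fin.cons a x ∈ S} ∂μ := by
  rw [← lintegral_indicator_one hS, lintegral_pi_fin_succ μ (measurable_one.indicator hS)]
  congr! 2 with a
  have : MeasurableSet {x : Fin n → α | Fin.cons a x ∈ S} := by
    have : Measurable fun x : Fin n → α => (Fin.cons a x : Fin (n + 1) → α) :=
      measurable_pi_iff.2 fun i => by
        refine Fin.cases ?_ (fun j => ?_) i
        · simp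
        · simpa using measurable_pi_apply j
    exact this hS
  rw [← lintegral_indicator_one this]
  rfl

lemma lintegral_multilinear_sq {n : ℕ} (b : OrthonormalBasis κ ℝ E)
    (f : ContinuousMultilinearMap ℝ (fun _ : Fin n => E) ℝ) :
    ∫⁻ x, ENNReal.ofReal (f x ^ 2) ∂(Measure.pi fun _ => stdGaussian E) =
      ENNReal.ofReal (basisSqSum b f) := by
  induction n with
  | zero =>
    simp only [lintegral_unique, basisSqSum, Fintype.sum_unique, measure_univ, mul_one]
    congr! 3
  | succ n ih =>
    have hf : Measurable f := f.cont.measurable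
    rw [lintegral_pi_fin_succ _ (by fun_prop)]
    have (a : E) : ∫⁻ x, ENNReal.ofReal (f (Fin.cons a x) ^ 2) ∂(Measure.pi fun _ => stdGaussian E)
        = ENNReal.ofReal (basisSqSum b (f.curryLeft a)) := ih (f.curryLeft a)
    simp_rw [this, basisSqSum_curryLeft, lintegral_stdGaussian_sum_dual_sq, basisSqSum_succ]

/-- Needed because `Real.log 0 = 0`: the logarithmic estimate does not see the zeros of the form. -/
lemma multilinear_ae_ne_zero {n : ℕ} (b : OrthonormalBasis κ ℝ E)
    (f : ContinuousMultilinearMap ℝ (fun _ : Fin n => E) ℝ) (hf : 0 < basisSqSum b f) :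
    (Measure.pi fun _ => stdGaussian E) {x | f x = 0} = 0 := by
  induction n with
  | zero =>
    have : {x | f x = 0} = ∅ := by
      ext x
      simp only [mem_ofPred_eq, mem_empty_iff_false, iff_false]
      intro h
      have h2 : (fun j => b ((default : Fin 0 → κ) j)) = x := Subsingleton.elim _ _
      simp only [basisSqSum, Fintype.sum_unique, h2, h] at hf
      norm_num at hf
    rw [this, measure_empty]
  | succ n ih =>
    have hm : Measurable f := f.cont.measurable
    have hS : MeasurableSet {x | f x = 0} := hm (measurableSet_singleton 0)
    rw [measure_pi_fin_succ _ hS]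
    refine lintegral_eq_zero_of_ae_eq_zero ?_
    rw [basisSqSum_succ] at hf
    filter_upwards [(stdGaussian_sum_dual_sq _ hf).1] with a ha
    exact ih (f.curryLeft a) (by rwa [basisSqSum_curryLeft])

/-- The shift `s` carries the deficit accumulated by the arguments already frozen. The positive part
is essential: the mean is bounded on one side only, so a negative `s` would leave a cross term of
the wrong sign in a plain square. -/
lemma lintegral_multilinear_log {n : ℕ} (b : OrthonormalBasis κ ℝ E)
    (f : ContinuousMultilinearMap ℝ (fun _ : Fin n => E) ℝ) (hf : 0 < basisSqSum b f) (s : ℝ) :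
    ∫⁻ x, ENNReal.ofReal ((max (n * Real.log gaussLogConst + Real.log (basisSqSum b f) -
        Real.log (f x ^ 2) + s) 0) ^ 2) ∂(Measure.pi fun _ => stdGaussian E) ≤
      ENNReal.ofReal ((max s 0) ^ 2 + 8 * n) := by
  induction n generalizing s with
  | zero =>
    simp only [lintegral_unique, basisSqSum, Fintype.sum_unique, measure_univ, mul_one]
    refine ENNReal.ofReal_le_ofReal (le_of_eq ?_)
    have h2 : (fun j => b ((default : Fin 0 → κ) j)) = default := Subsingleton.elim _ _
    rw [h2]
    simp
  | succ n ih =>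
    have hm : Measurable f := f.cont.measurable
    rw [lintegral_pi_fin_succ _ (by fun_prop)]
    have hf' := hf
    rw [basisSqSum_succ] at hf'
    obtain ⟨h0, h1⟩ := stdGaussian_sum_dual_sq _ hf'
    rw [← basisSqSum_succ] at h1
    simp_rw [← basisSqSum_curryLeft] at h0 h1
    calc _ ≤ ∫⁻ a, (ENNReal.ofReal ((max (Real.log gaussLogConst + Real.log (basisSqSum b f) -
          Real.log (basisSqSum b (f.curryLeft a)) + s) 0) ^ 2) + ENNReal.ofReal (8 * n))
            ∂(stdGaussian E) := by
          refine lintegral_mono_ae ?_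
          filter_upwards [h0] with a ha
          rw [← ENNReal.ofReal_add (sq_nonneg _) (by positivity)]
          refine le_trans (le_of_eq ?_) (ih (f.curryLeft a) ha
            (Real.log gaussLogConst + Real.log (basisSqSum b f) -
              Real.log (basisSqSum b (f.curryLeft a)) + s))
          refine lintegral_congr fun x => ?_
          rw [ContinuousMultilinearMap.curryLeft_apply]
          congr 3
          push_cast
          ring
      _ ≤ ENNReal.ofReal ((max s 0) ^ 2 + 8) + ENNReal.ofReal (8 * n) := by
          rw [lintegral_add_right _ measurable_const, lintegral_const, measure_univ, mul_one]
          gcongr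
          exact h1 s
      _ = _ := by
          rw [← ENNReal.ofReal_add (by positivity) (by positivity)]
          congr 1
          push_cast
          ring

end Multilinear

/-! ### The mixed discriminant as a sum over permutations and as a sum of squared determinants. -/

section MixedDiscriminant

variable {n : ℕ}

/-- The variables are distinct and absent from `m`, so every factor `m k + 1` produced by
differentiation is `1`. -/
lemma coeff_foldr_pderiv {σ : Type*} [DecidableEq σ] (p : MvPolynomial σ ℝ) (l : List σ)
    (hl : l.Nodup) (m : σ →₀ ℕ) (hm : ∀ k ∈ l, m k = 0) :
    (l.foldr (fun k p => MvPolynomial.pderiv k p) p).coeff m =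
      p.coeff (m + (l.map fun k => Finsupp.single k 1).sum) := by
  induction l generalizing m with
  | nil => simp
  | cons k l ih =>
    rw [List.nodup_cons] at hl
    rw [List.foldr_cons, MvPolynomial.coeff_pderiv, ih hl.2, hm k (by simp), List.map_cons, List.sum_cons]
    · simp [add_assoc]
    · intro j hj
      have : j ≠ k := fun h => hl.1 (h ▸ hj)
      simp [hm j (by simp [hj]), this]

lemma sum_single_eq_iff_bijective (g : Fin n → Fin n) :
    ∑ i, Finsupp.single (g i) 1 = ∑ k : Fin n, Finsupp.single k 1 ↔ Function.Bijective g := by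
  constructor
  · intro h
    refine Function.Surjective.bijective_of_finite fun k => ?_
    have := DFunLike.congr_fun h k
    simp only [Finsupp.coe_finsetSum, Finset.sum_apply, Finsupp.single_apply] at this
    by_contra hk
    push Not at hk
    simp [hk] at this
  · intro h
    exact h.sum_comp fun k => Finsupp.single k 1

/-- Expanding the product, a choice `g` of one term per factor contributes to the squarefree
monomial exactly when `g` is a bijection. -/
lemma coeff_prod_sum_X (a : Fin n → Fin n → ℝ) :
    (∏ i, ∑ k, (MvPolynomial.X k * MvPolynomial.C (a k i) : MvPolynomial (Fin n) ℝ)).coeff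
        (∑ k, Finsupp.single k 1) = ∑ π : Equiv.Perm (Fin n), ∏ i, a (π i) i := by
  rw [Finset.prod_univ_sum, Fintype.piFinset_univ, MvPolynomial.coeff_sum]
  have h (g : Fin n → Fin n) :
      (∏ i, (MvPolynomial.X (g i) * MvPolynomial.C (a (g i) i) : MvPolynomial (Fin n) ℝ)).coeff
        (∑ k, Finsupp.single k 1) = if Function.Bijective g then ∏ i, a (g i) i else 0 := by
    have e : ∏ i, (MvPolynomial.X (g i) * MvPolynomial.C (a (g i) i) : MvPolynomial (Fin n) ℝ) =
        MvPolynomial.monomial (∑ i, Finsupp.single (g i) 1) (∏ i, a (g i) i) := by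
      rw [Finset.prod_mul_distrib, MvPolynomial.monomial_sum_index, map_prod, mul_comm]
      rfl
    rw [e, MvPolynomial.coeff_monomial]
    simp only [sum_single_eq_iff_bijective]
  simp only [h]
  symm
  refine Finset.sum_of_injOn (fun π i => π i) (fun π _ ρ _ h => DFunLike.coe_injective h)
    (fun _ _ => Finset.mem_coe.2 (Finset.mem_univ _)) ?_ ?_
  · intro g _ hg
    refine if_neg fun hb => hg ⟨Equiv.ofBijective g hb, by simp, rfl⟩
  · intro π _
    exact (if_pos π.bijective).symm

lemma mixedDiscriminant_eq_sum (Q : Fin n → Matrix (Fin n) (Fin n) ℝ) :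
    mixedDiscriminant Q = ∑ τ : Equiv.Perm (Fin n), ∑ π : Equiv.Perm (Fin n),
      (Equiv.Perm.sign τ : ℝ) * ∏ i, Q (π i) (τ i) i := by
  have h0 : detPencil Q = ∑ τ : Equiv.Perm (Fin n), MvPolynomial.C (Equiv.Perm.sign τ : ℝ) *
      ∏ i, ∑ k, (MvPolynomial.X k * MvPolynomial.C (Q k (τ i) i)) := by
    rw [detPencil, Matrix.det_apply']
    refine Finset.sum_congr rfl fun τ _ => ?_
    congr 1
    refine Finset.prod_congr rfl fun i _ => ?_
    simp [Matrix.sum_apply]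
  rw [mixedDiscriminant, MvPolynomial.eval_zero, MvPolynomial.constantCoeff_eq,
    coeff_foldr_pderiv _ _ (List.nodup_finRange n) 0 (by simp), h0, zero_add,
    ← List.ofFn_eq_map, List.sum_ofFn, MvPolynomial.coeff_sum]
  simp only [MvPolynomial.coeff_C_mul, coeff_prod_sum_X, Finset.mul_sum]

lemma mixedDiscriminant_eq_sum_sum (Q : Fin n → Matrix (Fin n) (Fin n) ℝ) :
    mixedDiscriminant Q = ∑ σ : Equiv.Perm (Fin n), ∑ τ : Equiv.Perm (Fin n),
      (Equiv.Perm.sign σ : ℝ) * (Equiv.Perm.sign τ : ℝ) * ∏ j, Q j (σ j) (τ j) := by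
  rw [mixedDiscriminant_eq_sum, Finset.sum_comm]
  conv_rhs => rw [Finset.sum_comm]
  -- Reindex by `j = π i`: the row permutation becomes `τ π⁻¹`, the column permutation `π⁻¹`, and
  -- the two signs multiply to `sign τ`.
  refine Fintype.sum_equiv (Equiv.inv _) _ _ fun π => ?_
  refine Fintype.sum_equiv (Equiv.mulRight π⁻¹) _ _ fun τ => ?_
  have h : ∏ i, Q (π i) (τ i) i =
      ∏ j, Q j ((τ * π⁻¹) j) (π⁻¹ j) := by
    conv_rhs => rw [← Equiv.prod_comp π]
    simp
  have h1 : (Equiv.Perm.sign π : ℝ) * (Equiv.Perm.sign π : ℝ) = 1 := by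
    rw [← Int.cast_mul, ← Units.val_mul, Int.units_mul_self]
    simp
  simp only [Equiv.coe_mulRight, Equiv.inv_apply, Equiv.Perm.sign_mul, Equiv.Perm.sign_inv, h,
    Units.val_mul, Int.cast_mul, mul_assoc _ _ (Equiv.Perm.sign π : ℝ), h1, mul_one]

/-- The determinant with columns `Tⱼ xⱼ`, as a multilinear form in the vectors `xⱼ`. -/
noncomputable def detColumnsMultilinear (T : Fin n → Matrix (Fin n) (Fin n) ℝ) :
    ContinuousMultilinearMap ℝ (fun _ : Fin n => EuclideanSpace ℝ (Fin n)) ℝ where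
  toMultilinearMap := (Matrix.detRowAlternating (R := ℝ) (n := Fin n)).toMultilinearMap.compLinearMap
    fun j => (T j).mulVecLin ∘ₗ (WithLp.linearEquiv 2 ℝ (Fin n → ℝ)).toLinearMap
  cont := by
    change Continuous fun x : Fin n → EuclideanSpace ℝ (Fin n) =>
      (Matrix.of fun j => T j *ᵥ (x j).ofLp).det
    fun_prop

lemma detColumnsMultilinear_apply (T : Fin n → Matrix (Fin n) (Fin n) ℝ)
    (x : Fin n → EuclideanSpace ℝ (Fin n)) :
    detColumnsMultilinear T x = (Matrix.of fun i j => (T j *ᵥ (x j).ofLp) i).det := by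
  rw [← Matrix.det_transpose]
  rfl

lemma detColumnsMultilinear_sq (T : Fin n → Matrix (Fin n) (Fin n) ℝ)
    (x : Fin n → EuclideanSpace ℝ (Fin n)) :
    detColumnsMultilinear T x ^ 2 = sqDetColumns T x := by
  rw [detColumnsMultilinear_apply, sqDetColumns]

lemma basisSqSum_detColumnsMultilinear (Q T : Fin n → Matrix (Fin n) (Fin n) ℝ)
    (hT : ∀ i, Q i = T i * (T i)ᵀ) :
    basisSqSum (EuclideanSpace.basisFun (Fin n) ℝ) (detColumnsMultilinear T) =
      mixedDiscriminant Q := by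
  have h (c : Fin n → Fin n) : detColumnsMultilinear T
      (fun j => EuclideanSpace.basisFun (Fin n) ℝ (c j)) =
        ∑ σ : Equiv.Perm (Fin n), (Equiv.Perm.sign σ : ℝ) * ∏ j, T j (σ j) (c j) := by
    rw [detColumnsMultilinear_apply, Matrix.det_apply']
    simp [Matrix.col]
  simp only [basisSqSum, h, sq, Finset.sum_mul_sum]
  rw [mixedDiscriminant_eq_sum_sum, Finset.sum_comm]
  refine Finset.sum_congr rfl fun σ _ => ?_
  rw [Finset.sum_comm]
  refine Finset.sum_congr rfl fun τ _ => ?_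
  simp only [hT, Matrix.mul_apply, Matrix.transpose_apply]
  -- The product over `j` of the entries of `T j (T j)ᵀ` opens into a sum over tuples `c`, matching
  -- the sum over basis tuples.
  rw [Finset.prod_univ_sum, Fintype.piFinset_univ, Finset.mul_sum]
  refine Finset.sum_congr rfl fun c _ => ?_
  rw [Finset.prod_mul_distrib]
  ring

end MixedDiscriminant

/-! ### Moments and the lower tail under the product Gaussian measure. -/

section Tail

variable {n : ℕ}

lemma measurable_sqDetColumns (T : Fin n → Matrix (Fin n) (Fin n) ℝ) :
    Measurable (sqDetColumns T) := by
  have : sqDetColumns T = fun x => detColumnsMultilinear T x ^ 2 :=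
    funext fun x => (detColumnsMultilinear_sq T x).symm
  rw [this]
  exact (detColumnsMultilinear T).cont.measurable.pow_const 2

lemma sqDetColumns_nonneg (T : Fin n → Matrix (Fin n) (Fin n) ℝ)
    (x : Fin n → EuclideanSpace ℝ (Fin n)) : 0 ≤ sqDetColumns T x := sq_nonneg _

lemma integral_sqDetColumns (Q T : Fin n → Matrix (Fin n) (Fin n) ℝ)
    (hT : ∀ i, Q i = T i * (T i)ᵀ) :
    Integrable (sqDetColumns T)
        (Measure.pi fun _ => stdGaussian (EuclideanSpace ℝ (Fin n))) ∧
      ∫ x, sqDetColumns T x ∂(Measure.pi fun _ => stdGaussian (EuclideanSpace ℝ (Fin n))) =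
        mixedDiscriminant Q := by
  have h := lintegral_multilinear_sq (EuclideanSpace.basisFun (Fin n) ℝ) (detColumnsMultilinear T)
  have hD := basisSqSum_nonneg (EuclideanSpace.basisFun (Fin n) ℝ) (detColumnsMultilinear T)
  simp_rw [basisSqSum_detColumnsMultilinear Q T hT, detColumnsMultilinear_sq] at h hD
  have hm := (measurable_sqDetColumns T).aestronglyMeasurable
    (μ := Measure.pi fun _ => stdGaussian (EuclideanSpace ℝ (Fin n)))
  have h0 := ae_of_all (Measure.pi fun _ => stdGaussian (EuclideanSpace ℝ (Fin n)))
    (sqDetColumns_nonneg T)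
  refine ⟨⟨hm, ?_⟩, ?_⟩
  · rw [hasFiniteIntegral_iff_ofReal h0, h]
    exact ENNReal.ofReal_lt_top
  · rw [integral_eq_lintegral_of_nonneg_ae h0 hm, h, ENNReal.toReal_ofReal hD]

lemma gaussLogConst_pos : 0 < gaussLogConst := Real.exp_pos _

lemma sqDetColumns_lower_tail (hn : 1 ≤ n) (Q T : Fin n → Matrix (Fin n) (Fin n) ℝ)
    (hT : ∀ i, Q i = T i * (T i)ᵀ) (hD : mixedDiscriminant Q ≠ 0) {ε : ℝ} (h0 : 0 < ε)
    (h1 : ε < 1) :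
    (Measure.pi fun _ => stdGaussian (EuclideanSpace ℝ (Fin n))).real
        {x | sqDetColumns T x ≤ (ε * gaussLogConst) ^ n * mixedDiscriminant Q} ≤
      8 / (n * Real.log ε ^ 2) := by
  set μ := Measure.pi fun _ : Fin n => stdGaussian (EuclideanSpace ℝ (Fin n)) with hμ
  have hb := basisSqSum_detColumnsMultilinear Q T hT
  have hpos : 0 < mixedDiscriminant Q :=
    lt_of_le_of_ne (hb ▸ basisSqSum_nonneg _ _) hD.symm
  have hz := multilinear_ae_ne_zero (EuclideanSpace.basisFun (Fin n) ℝ)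
    (detColumnsMultilinear T) (hb ▸ hpos)
  have hl := lintegral_multilinear_log (EuclideanSpace.basisFun (Fin n) ℝ)
    (detColumnsMultilinear T) (hb ▸ hpos) 0
  rw [← hμ] at hz hl
  simp_rw [hb, detColumnsMultilinear_sq] at hl
  have hn0 : (0 : ℝ) < n := by exact_mod_cast hn
  have hε : Real.log ε < 0 := Real.log_neg h0 h1
  have hc : 0 < (n * Real.log ε) ^ 2 := by
    exact sq_pos_of_neg (mul_neg_of_pos_of_neg hn0 hε)
  have hmeas : Measurable (sqDetColumns T) := measurable_sqDetColumns T
  have hsub : {x | sqDetColumns T x ≤ (ε * gaussLogConst) ^ n * mixedDiscriminant Q} ⊆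
      {x | detColumnsMultilinear T x = 0} ∪ {x | ENNReal.ofReal ((n * Real.log ε) ^ 2) ≤
        ENNReal.ofReal ((max (n * Real.log gaussLogConst + Real.log (mixedDiscriminant Q) -
          Real.log (sqDetColumns T x) + 0) 0) ^ 2)} := by
    intro x hx
    by_cases hx0 : detColumnsMultilinear T x = 0
    · exact Or.inl hx0
    · refine Or.inr (ENNReal.ofReal_le_ofReal ?_)
      have hα : 0 < sqDetColumns T x := by
        rw [← detColumnsMultilinear_sq]
        positivity
      have h := Real.log_le_log hα (Set.mem_ofPred_eq ▸ hx)
      have hg := gaussLogConst_pos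
      rw [Real.log_mul (by positivity) hpos.ne', Real.log_pow,
        Real.log_mul h0.ne' hg.ne'] at h
      -- On the event the deficit is at least `-n log ε > 0`, so squaring preserves the inequality.
      rw [← neg_sq (n * Real.log ε)]
      refine pow_le_pow_left₀ ?_ (le_max_of_le_left (by linarith)) 2
      linarith [mul_neg_of_pos_of_neg hn0 hε]
  have hle : μ {x | sqDetColumns T x ≤ (ε * gaussLogConst) ^ n * mixedDiscriminant Q} ≤
      ENNReal.ofReal (8 / (n * Real.log ε ^ 2)) := by
    refine (measure_mono hsub).trans ((measure_union_le _ _).trans ?_)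
    rw [hz, zero_add]
    -- Markov for the squared deficit with `s = 0`: the quotient is `8 n / (n log ε)²`.
    refine (meas_ge_le_lintegral_div (by fun_prop) (ENNReal.ofReal_pos.2 hc).ne'
      ENNReal.ofReal_ne_top).trans ?_
    refine (ENNReal.div_le_div_right hl _).trans_eq ?_
    rw [← ENNReal.ofReal_div_of_pos hc]
    congr 1
    have := hε.ne
    simp
    field_simp
  exact ENNReal.toReal_le_of_le_ofReal (by positivity) hle

end Tail

theorem theorem2p2 {n : ℕ} (hn : 1 ≤ n)
    (Q T : Fin n → Matrix (Fin n) (Fin n) ℝ)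
    (hQ : ∀ i, (Q i).PosSemidef) (hT : ∀ i, Q i = T i * (T i)ᵀ)
    {Ω : Type*} [MeasurableSpace Ω] (P : Measure Ω) [IsProbabilityMeasure P]
    (u : Fin n → Ω → EuclideanSpace ℝ (Fin n))
    (hu : ∀ i, HasLaw (u i) (stdGaussian (EuclideanSpace ℝ (Fin n))) P)
    (hind : iIndepFun u P) :
    -- the expectation of `α` exists and equals the mixed discriminant
    (Integrable (fun ω => sqDetColumns T (fun i => u i ω)) P ∧
      ∫ ω, sqDetColumns T (fun i => u i ω) ∂P = mixedDiscriminant Q) ∧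
    -- upper tail
    (mixedDiscriminant Q ≠ 0 → ∀ C : ℝ, 1 < C →
      P.real {ω | C * mixedDiscriminant Q ≤ sqDetColumns T (fun i => u i ω)} ≤ C⁻¹) ∧
    -- the integral in the exponent of `c₀` converges, and the numerical value of `c₀`
    (IntegrableOn (fun t : ℝ => Real.log t * Real.exp (-t ^ 2 / 2)) (Set.Ioi 0) ∧
      |gaussLogConst - 0.2807297419| < 10 ^ (-9 : ℤ)) ∧
    -- lower tail
    (mixedDiscriminant Q ≠ 0 → ∀ ε : ℝ, 0 < ε → ε < 1 →
      P.real {ω | sqDetColumns T (fun i => u i ω) ≤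
          (ε * gaussLogConst) ^ n * mixedDiscriminant Q} ≤
        8 / (n * Real.log ε ^ 2)) := by
  have hum : ∀ i, AEMeasurable (u i) P := fun i => (hu i).aemeasurable
  have hU : AEMeasurable (fun ω i => u i ω) P := aemeasurable_pi_iff.2 hum
  -- Independence makes the joint law a product measure, so everything transfers from there.
  have hlaw : P.map (fun ω i => u i ω) =
      Measure.pi fun _ : Fin n => stdGaussian (EuclideanSpace ℝ (Fin n)) := by
    rw [(iIndepFun_iff_map_fun_eq_pi_map hum).1 hind]
    simp_rw [(hu _).map_eq]
  have hmeas := measurable_sqDetColumns T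
  obtain ⟨hi, hE⟩ := integral_sqDetColumns Q T hT
  rw [← hlaw] at hi hE
  rw [integral_map hU hi.aestronglyMeasurable] at hE
  have hi' : Integrable (fun ω => sqDetColumns T (fun i => u i ω)) P := hi.comp_aemeasurable hU
  refine ⟨⟨hi', hE⟩, fun hD C hC => ?_, ⟨integrableOn_log_mul_exp_neg_sq_div_two, ?_⟩,
    fun hD ε h0 h1 => ?_⟩
  · have hpos : 0 < mixedDiscriminant Q :=
      lt_of_le_of_ne (hE ▸ integral_nonneg fun ω => sqDetColumns_nonneg T _) hD.symm
    have h := mul_meas_ge_le_integral_of_nonneg (ae_of_all P fun ω => sqDetColumns_nonneg T _) hi'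
      (C * mixedDiscriminant Q)
    rw [hE] at h
    have hC0 : 0 < C := by linarith
    rw [inv_eq_one_div, le_div_iff₀ hC0]
    refine le_of_mul_le_mul_right ?_ hpos
    linarith
  · rw [gaussLogConst_eq]
    exact abs_exp_neg_eulerMascheroniConstant_sub_log_two_sub_lt
  · have h := sqDetColumns_lower_tail hn Q T hT hD h0 h1
    have hS : MeasurableSet {x | sqDetColumns T x ≤
        (ε * gaussLogConst) ^ n * mixedDiscriminant Q} := hmeas measurableSet_Iic
    rwa [← hlaw, map_measureReal_apply_of_aemeasurable hU hS] at h
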